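/- Let $\mathcal A$ be a set of agents, $\mathcal I$ a set of institutions, and $\mathcal X$ a finite set of contracts. Each $x\in\mathcal X$ has an agent $\alpha(x)\in\mathcal A$ and an institution in $\mathcal I$. For $X\subseteq\mathcal X$ let $X_a$ and $X_i$ be the sets of contracts in $X$ of agent $a$ and of institution $i$. Each institution $i$ has a capacity $q_i\in\mathbb N$, a linear priority order $\succ_i$ on $\mathcal X_i$, and a matroid $(\mathcal X_i,\mathcal F_i)$ with rank function $r_i$ all of whose independent sets have cardinality at most $q_i$. A matching is a set $X\subseteq\mathcal X$ with $|X_a|\le 1$ for every agent $a$. A problem is a profile $R=(R_a)_{a\in\mathcal A}$, where $R_a$ is a linear order on $\mathcal X_a\cup\{\emptyset\}$ with strict part $P_a$, and $\emptyset$ is the null contract; $x$ is acceptable if $x\mathrel{R_a}\emptyset$. For a matching $X$ we also write $X_a\in\mathcal X_a\cup\{\emptyset\}$ for the assignment of $a$. A matching rule $\varphi$ assigns a matching $\varphi(R)$ to every problem $R$. The non-wasteful matroid choice rule $C^m_i$ of institution $i$ chooses from $Y\subseteq\mathcal X_i$ as follows. Step 1 (greedy rule): go through $Y$ from the highest to the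 lowest priority, and add a contract to the chosen set whenever the resulting set is in $\mathcal F_i$. Step 2: add the remaining contracts of $Y$ in order of priority until $q_i$ contracts are chosen or all of $Y$ is chosen. DA based on $(C^m_i)_{i\in\mathcal I}$ is the matching rule given by the deferred-acceptance algorithm: at each step, each agent without a tentatively accepted contract proposes its most preferred acceptable contract that has not yet been rejected (if there is one); each institution $i$ applies $C^m_i$ to its tentatively accepted contracts together with the new proposals, tentatively accepts the chosen ones and permanently rejects the others. The algorithm stops at the first step without a rejection, and the contracts then tentatively accepted form the outcome. **Corollary.** A matching rule $\varphi$ is DA based on $(C^m_i)_{i\in\mathcal I}$ if and only if $\varphi$ is strategy-proof, i.e. $\varphi_a(R)\mathrel{R_a}\varphi_a(R'_a,R_{-a})$ for all $R$, $a$ and $R'_a$, and for every problem $R$ the matching $X=\varphi(R)$ satisfies: - non-wastefulness: for every $i$, $|X_i|\le q_i$, and if some $x\in\mathcal X_i$ has $x\mathrel{P_{\alpha(x)}}X_{\alpha(x)}$, then $|X_i|=q_i$; - no justified envy under rank: for every $i$, $x\in X_i$ and $y\in\mathcal X_i\setminus X_i$ with $y\mathrel{P_{\alpha(y)}}X_{\alpha(y)}$,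 if $y\succ_i x$ then $r_i((X_i\setminus\{x\})\cup\{y\})<r_i(X_i)$; - matroidal objectives: for every $i$ and $x\in\mathcal X_i\setminus X_i$ with $x\mathrel{P_{\alpha(x)}}X_{\alpha(x)}$, $r_i(X_i\cup\{x\})=r_i(X_i)$; - individual rationality: $X_a\mathrel{R_a}\emptyset$ for every agent $a$. -/

import Mathlib

namespace MatroidDA

noncomputable section

open Classical

/-- A linear order, written as "weakly better than": `R.ge x y` means that `x` is at least as good
as (or has weakly higher priority than) `y`. -/
structure LinPref (T : Type*) where
  ge : T → T → Prop
  linear : IsLinearOrder T ge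

/-- The strict part of a linear order. -/
def LinPref.gt {T : Type*} (R : LinPref T) (x y : T) : Prop :=
  R.ge x y ∧ x ≠ y

instance {T : Type*} (R : LinPref T) : IsLinearOrder T R.ge := R.linear

/-- The elements of `Y`, listed from the highest to the lowest. -/
def LinPref.ranking {T : Type*} (R : LinPref T) (Y : Finset T) : List T :=
  Y.sort R.ge

section Choice

variable {T : Type*}

/-- A choice rule on a set `T` of contracts: it selects a subset of each choice problem. -/
structure ChoiceRule (T : Type*) where
  choose : Finset T → Finset T
  choose_subset : ∀ Y, choose Y ⊆ Y

/-- One step of the greedy choice rule. -/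
def greedyStep (M : Matroid T) (S : Finset T) (x : T) : Finset T :=
  if M.Indep (insert x S : Finset T) then insert x S else S

/-- The greedy choice rule: the contracts of `Y` are considered from the highest to the lowest
priority, and each is added whenever this keeps the chosen set independent. -/
def greedy (M : Matroid T) (prio : LinPref T) (Y : Finset T) : Finset T :=
  (prio.ranking Y).foldl (greedyStep M) ∅

/-- The contracts chosen by the non-wasteful matroid choice rule with capacity `q`: first apply the
greedy rule, then fill the remaining seats with the remaining contracts of highest priority until
all seats are filled or all contracts are chosen. -/
def matroidChoose (M : Matroid T) (prio : LinPref T) (q : ℕ) (Y : Finset T) : Finset T :=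
  greedy M prio Y ∪
    ((prio.ranking (Y \ greedy M prio Y)).take (q - (greedy M prio Y).card)).toFinset

theorem foldl_greedyStep_subset (M : Matroid T) (l : List T) (S Y : Finset T)
    (hS : S ⊆ Y) (hl : ∀ x ∈ l, x ∈ Y) : l.foldl (greedyStep M) S ⊆ Y := by
  induction l generalizing S with
  | nil => simpa using hS
  | cons x l ih =>
    rw [List.foldl_cons]
    refine ih _ ?_ fun y hy => hl y (List.mem_cons_of_mem _ hy)
    unfold greedyStep
    split_ifs
    · exact Finset.insert_subset (hl x List.mem_cons_self) hS
    · exact hS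

theorem greedy_subset (M : Matroid T) (prio : LinPref T) (Y : Finset T) :
    greedy M prio Y ⊆ Y :=
  foldl_greedyStep_subset M _ _ _ (Finset.empty_subset _) fun x hx => by
    simpa [LinPref.ranking] using hx

/-- The non-wasteful matroid choice rule. -/
def matroidChoice (M : Matroid T) (prio : LinPref T) (q : ℕ) : ChoiceRule T where
  choose := matroidChoose M prio q
  choose_subset Y := by
    refine Finset.union_subset (greedy_subset M prio Y) fun x hx => ?_
    have h := List.mem_of_mem_take (List.mem_toFinset.1 hx)
    simp only [LinPref.ranking, Finset.mem_sort, Finset.mem_sdiff] at h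
    exact h.1

end Choice

/-- For `f = agent`, the set of contracts of agent `b`; for `f = inst`, the set of contracts of
institution `b`. -/
abbrev ContractsOf {X B : Type*} (f : X → B) (b : B) : Type _ := {x : X // f x = b}

/-- The contracts in `Z` that belong to `b`. -/
def part {X B : Type*} (f : X → B) (Z : Finset X) (b : B) : Finset (ContractsOf f b) :=
  Z.subtype fun x => f x = b

section Matchings

variable {A I X : Type*} (agent : X → A) (inst : X → I)

/-- A matching: a set of contracts with at most one contract for each agent. -/
structure Matching where
  contracts : Finset X
  card_le_one : ∀ a, (part agent contracts a).card ≤ 1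

/-- A matching problem: each agent has a linear order over its contracts and the null contract
`none`. -/
abbrev Problem := (a : A) → LinPref (Option (ContractsOf agent a))

/-- A matching rule associates a matching with each problem. -/
abbrev MatchingRule := Problem agent → Matching agent

variable {agent}

/-- The contract of agent `a` in the matching, `none` if the agent has no contract. -/
def Matching.assignment (Z : Matching agent) (a : A) : Option (ContractsOf agent a) :=
  if h : ∃ x : ContractsOf agent a, x.1 ∈ Z.contracts then some h.choose else none

/-- The agent of the contract `x` strictly prefers `x` to its assignment in `Z`. -/
def Prefers (R : Problem agent) (Z : Matching agent) (x : X) : Prop :=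
  (R (agent x)).gt (some ⟨x, rfl⟩) (Z.assignment (agent x))

/-- Individual rationality of a matching. -/
def IndividuallyRational (R : Problem agent) (Z : Matching agent) : Prop :=
  ∀ a, (R a).ge (Z.assignment a) none

/-- Non-wastefulness of a matching, for the capacities `q`. -/
def NonWasteful (q : I → ℕ) (R : Problem agent) (Z : Matching agent) : Prop :=
  ∀ i, (part inst Z.contracts i).card ≤ q i ∧
    ∀ x : ContractsOf inst i, Prefers R Z x.1 → (part inst Z.contracts i).card = q i

/-- Matroidal objectives of a matching: no institution can increase the rank of its contracts with
a contract whose agent prefers it to its assignment. -/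
def MatroidalObjectives (M : (i : I) → Matroid (ContractsOf inst i))
    (R : Problem agent) (Z : Matching agent) : Prop :=
  ∀ i, ∀ x : ContractsOf inst i, x ∉ part inst Z.contracts i → Prefers R Z x.1 →
    (M i).eRk (insert x (part inst Z.contracts i) : Finset _) =
      (M i).eRk (part inst Z.contracts i)

/-- No justified envy under rank of a matching. -/
def NoJustifiedEnvyUnderRank (M : (i : I) → Matroid (ContractsOf inst i))
    (prio : (i : I) → LinPref (ContractsOf inst i))
    (R : Problem agent) (Z : Matching agent) : Prop :=
  ∀ i, ∀ x ∈ part inst Z.contracts i, ∀ y : ContractsOf inst i,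
    y ∉ part inst Z.contracts i → Prefers R Z y.1 → (prio i).gt y x →
      (M i).eRk (insert y ((part inst Z.contracts i).erase x) : Finset _) <
        (M i).eRk (part inst Z.contracts i)

/-- Strategy-proofness of a matching rule. -/
def StrategyProof (φ : MatchingRule agent) : Prop :=
  ∀ (R : Problem agent) (a : A) (R' : LinPref (Option (ContractsOf agent a))),
    (R a).ge ((φ R).assignment a) ((φ (Function.update R a R')).assignment a)

theorem part_card_le_one_iff (Z : Finset X) (a : A) : (part agent Z a).card ≤ 1 ↔
    ∀ x ∈ Z, ∀ y ∈ Z, agent x = a → agent y = a → x = y := by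
  simp only [Finset.card_le_one, part, Finset.mem_subtype, Subtype.forall, Subtype.mk.injEq]
  exact ⟨fun h x hx y hy ha hb => h x ha hx y hb hy, fun h x ha hx y hb hy => h x hx y hy ha hb⟩

end Matchings

section DeferredAcceptance

variable {A I X : Type*} [Fintype X] {agent : X → A} {inst : X → I}

/-- A state of the deferred-acceptance algorithm: the tentatively accepted contracts and the
permanently rejected contracts. -/
structure DAState (X : Type*) where
  held : Finset X
  rejected : Finset X

/-- The new proposals: each agent without a tentatively accepted contract proposes its most
preferred acceptable contract among those not yet rejected, if there is one. -/
def newProposals (R : Problem agent) (s : DAState X) : Finset X :=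
  Finset.univ.filter fun x =>
    (∀ y ∈ s.held, agent y ≠ agent x) ∧ x ∉ s.rejected ∧
      (R (agent x)).ge (some ⟨x, rfl⟩) none ∧
      ∀ y : ContractsOf agent (agent x), y.1 ∉ s.rejected →
        (R (agent x)).ge (some ⟨x, rfl⟩) (some y)

/-- The contracts considered at a step: the tentatively accepted ones and the new proposals. -/
def considered (R : Problem agent) (s : DAState X) : Finset X :=
  s.held ∪ newProposals R s

/-- The contracts that are chosen from `Z` by their institutions. -/
def accepted (C : (i : I) → ChoiceRule (ContractsOf inst i)) (Z : Finset X) : Finset X :=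
  Z.filter fun x => (⟨x, rfl⟩ : ContractsOf inst (inst x)) ∈
    (C (inst x)).choose (part inst Z (inst x))

/-- One step of the deferred-acceptance algorithm. -/
def daStep (C : (i : I) → ChoiceRule (ContractsOf inst i)) (R : Problem agent)
    (s : DAState X) : DAState X where
  held := accepted C (considered R s)
  rejected := s.rejected ∪ (considered R s \ accepted C (considered R s))

/-- Run the deferred-acceptance algorithm from the state `s`: it stops after the first step in
which no further contract is rejected, and returns the tentatively accepted contracts. -/
def daRun (C : (i : I) → ChoiceRule (ContractsOf inst i)) (R : Problem agent)
    (s : DAState X) : Finset X :=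
  if (daStep C R s).rejected = s.rejected then (daStep C R s).held
  else daRun C R (daStep C R s)
termination_by Fintype.card X - s.rejected.card
decreasing_by
  have hsub : s.rejected ⊂ (daStep C R s).rejected :=
    Finset.ssubset_iff_subset_ne.2 ⟨Finset.subset_union_left, fun h => by simp_all⟩
  have h1 := Finset.card_lt_card hsub
  have h2 := Finset.card_le_univ (daStep C R s).rejected
  omega

/-- The outcome of the deferred-acceptance algorithm; at the beginning nothing is held and nothing
is rejected. -/
def daOutcome (C : (i : I) → ChoiceRule (ContractsOf inst i)) (R : Problem agent) : Finset X :=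
  daRun C R ⟨∅, ∅⟩

theorem daStep_held_card_le_one (C : (i : I) → ChoiceRule (ContractsOf inst i))
    (R : Problem agent) (s : DAState X) (hs : ∀ a, (part agent s.held a).card ≤ 1) (a : A) :
    (part agent (daStep C R s).held a).card ≤ 1 := by
  have key : ∀ x ∈ considered R s, ∀ y ∈ considered R s, agent x = a → agent y = a → x = y := by
    intro x hx y hy hxa hya
    have hs' := (part_card_le_one_iff s.held a).1 (hs a)
    simp only [considered, newProposals, Finset.mem_union, Finset.mem_filter, Finset.mem_univ,
      true_and] at hx hy
    rcases hx with hx | ⟨hx1, hx2, -, hx3⟩ <;> rcases hy with hy | ⟨hy1, hy2, -, hy3⟩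
    · exact hs' x hx y hy hxa hya
    · exact absurd (hxa.trans hya.symm) (hy1 x hx)
    · exact absurd (hya.trans hxa.symm) (hx1 y hy)
    · subst hxa
      have h1 := hx3 ⟨y, hya⟩ hy2
      have h2 : ∀ (b : A) (hb : agent y = b) (z : ContractsOf agent b), z.1 ∉ s.rejected →
          (R b).ge (some ⟨y, hb⟩) (some z) := by
        rintro b rfl z hz
        exact hy3 z hz
      have h3 := h2 _ hya ⟨x, rfl⟩ hx2
      have h4 := (R (agent x)).linear.antisymm _ _ h1 h3
      simpa using h4
  rw [part_card_le_one_iff]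
  intro x hx y hy
  exact key x (Finset.mem_filter.1 hx).1 y (Finset.mem_filter.1 hy).1

theorem daRun_card_le_one (C : (i : I) → ChoiceRule (ContractsOf inst i))
    (R : Problem agent) (s : DAState X) (hs : ∀ a, (part agent s.held a).card ≤ 1) (a : A) :
    (part agent (daRun C R s) a).card ≤ 1 := by
  induction s using daRun.induct C R with
  | case1 s h =>
    rw [daRun, if_pos h]
    exact daStep_held_card_le_one C R s hs a
  | case2 s h ih =>
    rw [daRun, if_neg h]
    exact ih (daStep_held_card_le_one C R s hs)

/-- The deferred-acceptance rule based on the choice rule profile `C`. -/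
def daRule (C : (i : I) → ChoiceRule (ContractsOf inst i)) : MatchingRule agent := fun R =>
  { contracts := daOutcome C R
    card_le_one := daRun_card_le_one C R ⟨∅, ∅⟩ fun a => by simp [part] }

end DeferredAcceptance

end

end MatroidDA

open MatroidDA

/-!
The greedy set of a choice problem is the basis that is best in the priority order, and the
remaining seats go to the best remaining contracts. Conversely, full use of the capacity,
maximality of the rank and the absence of rank-preserving exchanges in favour of higher priorities
determine the chosen set. Hence a matching has the four properties at a problem exactly when it is
stable: it is individually rational, and each institution chooses its contracts when offered all
contracts that their agents weakly prefer to their assignments.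

Two properties of the choice rules then suffice. Path independence makes the outcome of deferred
acceptance stable and, for every agent, at least as good as any stable matching. The law of
aggregate demand adds the rural hospitals theorem: the same agents are unmatched in all stable
matchings. Therefore, if a stable rule can give an agent `x` at some report, then every stable rule
gives it a contract at least as good as `x` when it declares exactly these contracts acceptable. If
`x` comes from a profitable manipulation of deferred acceptance, this contradicts optimality. If `x`
is the agent's contract under deferred acceptance, strategy-proofness of another stable rule forces
that rule to be at least as good for the agent, hence equal to deferred acceptance.
-/

namespace MatroidDA

noncomputable section

open Classical

section Order

variable {T : Type*} (R : LinPref T)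

theorem LinPref.ge_refl (x : T) : R.ge x x := R.linear.refl x

theorem LinPref.ge_trans {x y z : T} (h : R.ge x y) (h' : R.ge y z) : R.ge x z :=
  R.linear.trans _ _ _ h h'

theorem LinPref.ge_antisymm {x y : T} (h : R.ge x y) (h' : R.ge y x) : x = y :=
  R.linear.antisymm _ _ h h'

theorem LinPref.not_ge {x y : T} : ¬ R.ge x y ↔ R.gt y x :=
  ⟨fun h => ⟨(R.linear.total x y).resolve_left h, fun hyx => h (hyx ▸ R.ge_refl y)⟩,
    fun h h' => h.2 (R.ge_antisymm h.1 h')⟩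

theorem LinPref.not_gt {x y : T} : ¬ R.gt x y ↔ R.ge y x := by
  rw [← R.not_ge, not_not]

theorem LinPref.gt_irrefl (x : T) : ¬ R.gt x x := fun h => h.2 rfl

theorem LinPref.gt_asymm {x y : T} (h : R.gt x y) : ¬ R.gt y x := R.not_gt.2 h.1

theorem LinPref.gt_of_gt_of_ge {x y z : T} (h : R.gt x y) (h' : R.ge y z) : R.gt x z := by
  rw [← R.not_ge] at h ⊢
  exact fun hzx => h (R.ge_trans h' hzx)

theorem LinPref.gt_trans {x y z : T} (h : R.gt x y) (h' : R.gt y z) : R.gt x z :=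
  R.gt_of_gt_of_ge h h'.1

theorem LinPref.mem_ranking {S : Finset T} {x : T} : x ∈ R.ranking S ↔ x ∈ S :=
  Finset.mem_sort _

theorem LinPref.ranking_pairwise_gt (S : Finset T) : (R.ranking S).Pairwise R.gt :=
  ((Finset.pairwise_sort S R.ge).and (Finset.sort_nodup S R.ge)).imp id

/-- The `k` highest elements of `S`, or all of `S` if it has fewer elements. -/
def LinPref.top (k : ℕ) (S : Finset T) : Finset T := ((R.ranking S).take k).toFinset

theorem LinPref.top_subset (k : ℕ) (S : Finset T) : R.top k S ⊆ S := fun _ hx =>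
  R.mem_ranking.1 (List.mem_of_mem_take (List.mem_toFinset.1 hx))

theorem LinPref.card_top (k : ℕ) (S : Finset T) : (R.top k S).card = min k S.card := by
  rw [top, List.toFinset_card_of_nodup, List.length_take, ranking, Finset.length_sort]
  exact (Finset.sort_nodup S R.ge).sublist (List.take_sublist _ _)

theorem LinPref.gt_of_mem_top {k : ℕ} {S : Finset T} {x y : T} (hx : x ∈ R.top k S) (hy : y ∈ S)
    (hy' : y ∉ R.top k S) : R.gt x y := by
  have hsplit := List.take_append_drop k (R.ranking S)
  have hpair := R.ranking_pairwise_gt S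
  rw [← R.mem_ranking, ← hsplit, List.mem_append] at hy
  rw [← hsplit, List.pairwise_append] at hpair
  exact hpair.2.2 x (List.mem_toFinset.1 hx) y
    (hy.resolve_left fun h => hy' (List.mem_toFinset.2 h))

theorem LinPref.exists_forall_ge {S : Finset T} (hS : S.Nonempty) :
    ∃ x ∈ S, ∀ y ∈ S, R.ge x y := by
  have hcard : (R.top 1 S).card = 1 := by
    rw [R.card_top, min_eq_left hS.card_pos]
  obtain ⟨x, hx⟩ := Finset.card_eq_one.1 hcard
  have hxtop : x ∈ R.top 1 S := hx ▸ Finset.mem_singleton_self x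
  refine ⟨x, R.top_subset 1 S hxtop, fun y hy => ?_⟩
  by_cases hyx : y = x
  · exact hyx ▸ R.ge_refl y
  · exact (R.gt_of_mem_top hxtop hy (by simpa [hx] using hyx)).1

theorem LinPref.top_eq {k : ℕ} {S U : Finset T} (hU : U ⊆ S) (hcard : U.card = min k S.card)
    (h : ∀ x ∈ U, ∀ y ∈ S, y ∉ U → R.gt x y) : R.top k S = U := by
  rw [← R.card_top k S] at hcard
  refine Finset.eq_of_subset_of_card_le (fun x hx => ?_) hcard.le
  by_contra hxU
  obtain ⟨y, hyU, hy⟩ : ∃ y ∈ U, y ∉ R.top k S := by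
    by_contra! hsub
    exact hxU (Finset.eq_of_subset_of_card_le hsub hcard.ge ▸ hx)
  exact R.gt_asymm (h y hyU x (R.top_subset k S hx) hxU) (R.gt_of_mem_top hx (hU hyU) hy)

theorem LinPref.mem_top_iff {k : ℕ} {S : Finset T} {x : T} (hx : x ∈ S) :
    x ∈ R.top k S ↔ (S.filter fun y => R.gt y x).card < k := by
  constructor
  · intro hxtop
    have hsub : S.filter (fun y => R.gt y x) ⊂ R.top k S := by
      refine Finset.ssubset_iff_of_subset (fun y hy => ?_) |>.2
        ⟨x, hxtop, fun h => R.gt_irrefl x (Finset.mem_filter.1 h).2⟩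
      obtain ⟨hyS, hyx⟩ := Finset.mem_filter.1 hy
      by_contra hytop
      exact R.gt_asymm hyx (R.gt_of_mem_top hxtop hyS hytop)
    exact (Finset.card_lt_card hsub).trans_le ((R.card_top k S).trans_le (min_le_left _ _))
  · intro hlt
    by_contra hxtop
    have hsub : R.top k S ⊆ S.filter fun y => R.gt y x := fun y hy =>
      Finset.mem_filter.2 ⟨R.top_subset k S hy, R.gt_of_mem_top hy hx hxtop⟩
    have hle := Finset.card_le_card hsub
    have htop : (R.top k S).card < S.card :=
      Finset.card_lt_card ⟨R.top_subset k S, fun h => hxtop (h hx)⟩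
    rw [R.card_top] at hle htop
    omega

end Order

section Exchange

variable {T : Type*} {M : Matroid T}

theorem exists_eRk_le_eRk_exchange {X U : Set T} {y : T} (hyX : y ∉ X) (hy : y ∈ M.closure X)
    (hyU : y ∉ M.closure (X ∩ U)) :
    ∃ x ∈ X, x ∉ U ∧ M.eRk X ≤ M.eRk (insert y (X \ {x})) := by
  obtain ⟨C, hCX, hC, hyC⟩ := Matroid.exists_isCircuit_of_mem_closure hy hyX
  have hCy : C \ {y} ⊆ X := Set.sdiff_singleton_subset_iff.2 hCX
  obtain ⟨x, hxC, hxU⟩ : ∃ x ∈ C \ {y}, x ∉ U := by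
    by_contra! hCU
    exact hyU (M.closure_subset_closure (Set.subset_inter hCy hCU)
      (hC.mem_closure_sdiff_singleton_of_mem hyC))
  have hxcl : x ∈ M.closure (insert y (X \ {x})) := by
    refine M.closure_subset_closure ?_ (hC.mem_closure_sdiff_singleton_of_mem hxC.1)
    exact fun z hz => (hCX hz.1).imp id fun hzX => ⟨hzX, hz.2⟩
  refine ⟨x, hCy hxC, hxU, ?_⟩
  calc M.eRk X ≤ M.eRk (insert x (insert y (X \ {x}))) := M.eRk_mono fun z hz => by
        by_cases hzx : z = x
        · exact Or.inl hzx
        · exact Or.inr (Or.inr ⟨hz, hzx⟩)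
    _ ≤ M.eRk (M.closure (insert y (X \ {x}))) := by
        rw [← M.eRk_insert_closure_eq, Set.insert_eq_of_mem hxcl]
    _ = M.eRk (insert y (X \ {x})) := M.eRk_closure_eq _

end Exchange

section Greedy

variable {T : Type*} {M : Matroid T}

theorem subset_greedyStep (S : Finset T) (x : T) : S ⊆ greedyStep M S x := by
  unfold greedyStep
  split_ifs
  exacts [Finset.subset_insert x S, Finset.Subset.refl S]

theorem greedyStep_subset_insert (S : Finset T) (x : T) : greedyStep M S x ⊆ insert x S := by
  unfold greedyStep
  split_ifs
  exacts [Finset.Subset.refl _, Finset.subset_insert x S]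

theorem greedyStep_indep {S : Finset T} (hS : M.Indep S) (x : T) :
    M.Indep (greedyStep M S x : Finset T) := by
  unfold greedyStep
  split_ifs with h
  exacts [h, hS]

theorem subset_foldl_greedyStep (l : List T) (S : Finset T) : S ⊆ l.foldl (greedyStep M) S := by
  induction l generalizing S with
  | nil => exact Finset.Subset.refl S
  | cons a l ih => exact (subset_greedyStep S a).trans (ih _)

theorem foldl_greedyStep_indep (l : List T) {S : Finset T} (hS : M.Indep S) :
    M.Indep (l.foldl (greedyStep M) S : Finset T) := by
  induction l generalizing S with
  | nil => exact hS
  | cons a _ ih => exact ih (greedyStep_indep hS a)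

variable (prio : LinPref T)

theorem not_indep_insert_of_notMem_foldl_greedyStep {l : List T} (hl : l.Pairwise prio.gt)
    {S : Finset T} (hS : ∀ s ∈ S, ∀ x ∈ l, prio.gt s x) {y : T} (hyl : y ∈ l)
    (hy : y ∉ l.foldl (greedyStep M) S) :
    ¬ M.Indep (insert y (↑(l.foldl (greedyStep M) S) ∩ {x | prio.gt x y})) := by
  induction l generalizing S with
  | nil => simp at hyl
  | cons a l ih =>
    obtain ⟨hal, hl⟩ := List.pairwise_cons.1 hl
    rw [List.foldl_cons] at hy ⊢
    rcases List.mem_cons.1 hyl with rfl | hyl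
    · intro hind
      have hstep : M.Indep (insert y S : Finset T) := by
        rw [Finset.coe_insert]
        refine hind.subset (Set.insert_subset_insert fun s hs => ⟨?_, hS s hs y List.mem_cons_self⟩)
        exact subset_foldl_greedyStep l _ (subset_greedyStep S y hs)
      refine hy (subset_foldl_greedyStep l _ ?_)
      rw [greedyStep, if_pos hstep]
      exact Finset.mem_insert_self y S
    · refine ih hl (fun s hs x hx => ?_) hyl hy
      rcases Finset.mem_insert.1 (greedyStep_subset_insert S a hs) with rfl | hs
      · exact hal x hx
      · exact hS s hs x (List.mem_cons_of_mem a hx)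

theorem greedy_indep (Y : Finset T) : M.Indep (greedy M prio Y : Finset T) :=
  foldl_greedyStep_indep _ (by simp)

theorem mem_greedy_iff_indep {Y : Finset T} {y : T} (hy : y ∈ Y) :
    y ∈ greedy M prio Y ↔ M.Indep (insert y (↑(greedy M prio Y) ∩ {x | prio.gt x y})) := by
  refine ⟨fun h => (greedy_indep prio Y).subset
    (Set.insert_subset h Set.inter_subset_left), fun h => ?_⟩
  by_contra hyG
  exact not_indep_insert_of_notMem_foldl_greedyStep prio (prio.ranking_pairwise_gt Y) (by simp)
    (prio.mem_ranking.2 hy) hyG h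

theorem greedy_inter_isBasis' (Y : Finset T) {U : Set T}
    (hU : ∀ ⦃x y⦄, y ∈ U → prio.gt x y → x ∈ U) :
    M.IsBasis' (↑(greedy M prio Y) ∩ U) (↑Y ∩ U) := by
  refine (Set.maximal_iff_forall_insert fun s t ht hst => ⟨ht.1.subset hst, hst.trans ht.2⟩).2
    ⟨⟨(greedy_indep prio Y).inter_right U, Set.inter_subset_inter_left U (greedy_subset M prio Y)⟩,
      fun y hy ⟨hind, hsub⟩ => ?_⟩
  obtain ⟨hyY, hyU⟩ := hsub (Set.mem_insert y _)
  refine hy ⟨(mem_greedy_iff_indep prio hyY).2 (hind.subset (Set.insert_subset_insert ?_)), hyU⟩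
  exact Set.inter_subset_inter_right _ fun x hxy => hU hyU hxy

theorem greedy_isBasis' (Y : Finset T) : M.IsBasis' (greedy M prio Y) Y := by
  simpa using greedy_inter_isBasis' prio Y (M := M) (U := Set.univ) fun _ _ _ _ => trivial

theorem mem_greedy_iff {Y : Finset T} {y : T} (hy : y ∈ Y) :
    y ∈ greedy M prio Y ↔ y ∈ M.E \ M.closure (↑Y ∩ {x | prio.gt x y}) := by
  have hbasis := greedy_inter_isBasis' (M := M) prio Y (U := {x | prio.gt x y})
    fun _ _ hz hxz => prio.gt_trans hxz hz
  rw [mem_greedy_iff_indep prio hy, ← hbasis.closure_eq_closure,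
    hbasis.indep.insert_indep_iff_of_notMem fun h => prio.gt_irrefl y h.2]

theorem eRk_eq_card_greedy (Y : Finset T) : M.eRk Y = (greedy M prio Y).card := by
  rw [(greedy_isBasis' prio Y).eRk_eq_encard, Set.encard_coe_eq_coe_finsetCard]

theorem card_greedy_mono {Y Y' : Finset T} (h : Y ⊆ Y') :
    (greedy M prio Y).card ≤ (greedy M prio Y').card := by
  have hrank := M.eRk_mono (Finset.coe_subset.2 h)
  rwa [eRk_eq_card_greedy prio, eRk_eq_card_greedy prio, Nat.cast_le] at hrank

theorem mem_greedy_of_subset {Y Y' : Finset T} (h : Y ⊆ Y') {x : T} (hx : x ∈ Y)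
    (hx' : x ∈ greedy M prio Y') : x ∈ greedy M prio Y := by
  obtain ⟨hxE, hxcl⟩ := (mem_greedy_iff prio (h hx)).1 hx'
  exact (mem_greedy_iff prio hx).2 ⟨hxE, fun hcl => hxcl (M.closure_subset_closure
    (Set.inter_subset_inter_left _ (Finset.coe_subset.2 h)) hcl)⟩

end Greedy

section MatroidChoice

variable {T : Type*} {M : Matroid T} (prio : LinPref T) {q : ℕ}

theorem matroidChoose_eq_greedy_union_top (Y : Finset T) : matroidChoose M prio q Y =
    greedy M prio Y ∪ prio.top (q - (greedy M prio Y).card) (Y \ greedy M prio Y) := rfl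

theorem matroidChoose_subset (Y : Finset T) : matroidChoose M prio q Y ⊆ Y :=
  (matroidChoice M prio q).choose_subset Y

theorem greedy_subset_matroidChoose (Y : Finset T) : greedy M prio Y ⊆ matroidChoose M prio q Y :=
  Finset.subset_union_left

theorem card_matroidChoose (hq : ∀ Y : Finset T, M.Indep Y → Y.card ≤ q) (Y : Finset T) :
    (matroidChoose M prio q Y).card = min q Y.card := by
  have hgreedy := hq _ (greedy_indep prio Y)
  have hsdiff := Finset.card_sdiff_add_card_eq_card (greedy_subset M prio Y)
  rw [matroidChoose_eq_greedy_union_top, Finset.card_union_of_disjoint, prio.card_top]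
  · omega
  · exact Finset.disjoint_of_subset_right (prio.top_subset _ _) Finset.disjoint_sdiff

theorem mem_matroidChoose_of_subset {Y Y' : Finset T} (h : Y ⊆ Y') {x : T} (hx : x ∈ Y)
    (hx' : x ∈ matroidChoose M prio q Y') : x ∈ matroidChoose M prio q Y := by
  rw [matroidChoose_eq_greedy_union_top, Finset.mem_union] at hx' ⊢
  by_cases hxG : x ∈ greedy M prio Y
  · exact Or.inl hxG
  have hxG' : x ∉ greedy M prio Y' := fun hxG' => hxG (mem_greedy_of_subset prio h hx hxG')
  have hsdiff : Y \ greedy M prio Y ⊆ Y' \ greedy M prio Y' := fun y hy => by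
    obtain ⟨hyY, hyG⟩ := Finset.mem_sdiff.1 hy
    exact Finset.mem_sdiff.2 ⟨h hyY, fun hyG' => hyG (mem_greedy_of_subset prio h hyY hyG')⟩
  have hxtop := (prio.mem_top_iff (Finset.mem_sdiff.2 ⟨h hx, hxG'⟩)).1 (hx'.resolve_left hxG')
  refine Or.inr ((prio.mem_top_iff (Finset.mem_sdiff.2 ⟨hx, hxG⟩)).2 ?_)
  calc ((Y \ greedy M prio Y).filter fun y => prio.gt y x).card
      ≤ ((Y' \ greedy M prio Y').filter fun y => prio.gt y x).card :=
        Finset.card_le_card (Finset.filter_subset_filter _ hsdiff)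
    _ < q - (greedy M prio Y').card := hxtop
    _ ≤ q - (greedy M prio Y).card := Nat.sub_le_sub_left (card_greedy_mono prio h) q

theorem eRk_matroidChoose (Y : Finset T) : M.eRk (matroidChoose M prio q Y) = M.eRk Y :=
  le_antisymm (M.eRk_mono (Finset.coe_subset.2 (matroidChoose_subset prio Y)))
    ((greedy_isBasis' prio Y).eRk_eq_eRk.symm.trans_le
      (M.eRk_mono (Finset.coe_subset.2 (greedy_subset_matroidChoose prio Y))))

theorem eRk_exchange_matroidChoose_lt {Y : Finset T} {x y : T} (hx : x ∈ matroidChoose M prio q Y)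
    (hy : y ∈ Y) (hy' : y ∉ matroidChoose M prio q Y) (hyx : prio.gt y x) :
    M.eRk (insert y (↑(matroidChoose M prio q Y) \ {x})) < M.eRk (matroidChoose M prio q Y) := by
  rw [matroidChoose_eq_greedy_union_top, Finset.notMem_union] at hy'
  have habove : ∀ z ∈ matroidChoose M prio q Y, z ∉ greedy M prio Y → prio.gt z y :=
    fun z hz hzG => prio.gt_of_mem_top ((Finset.mem_union.1 hz).resolve_left hzG)
      (Finset.mem_sdiff.2 ⟨hy, hy'.1⟩) hy'.2
  have hxG : x ∈ greedy M prio Y := by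
    by_contra hxG
    exact prio.gt_asymm hyx (habove x hx hxG)
  have hbasis := greedy_inter_isBasis' (M := M) prio Y (U := {z | prio.ge z y})
    fun _ _ hz hzw => prio.ge_trans hzw.1 hz
  have hsub : insert y (↑(matroidChoose M prio q Y) \ {x}) ⊆
      (↑Y ∩ {z | prio.ge z y}) ∪ (↑(greedy M prio Y) \ {x} : Set T) := by
    rintro z (rfl | ⟨hz, hzx⟩)
    · exact Or.inl ⟨hy, prio.ge_refl z⟩
    · by_cases hzG : z ∈ greedy M prio Y
      · exact Or.inr ⟨hzG, hzx⟩
      · exact Or.inl ⟨matroidChoose_subset prio Y hz, (habove z hz hzG).1⟩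
  have hunion : (↑(greedy M prio Y) ∩ {z | prio.ge z y}) ∪ (↑(greedy M prio Y) \ {x} : Set T) ⊆
      ↑((greedy M prio Y).erase x) := by
    rw [Finset.coe_erase]
    refine Set.union_subset (fun z hz => ⟨hz.1, ?_⟩) (Set.Subset.refl _)
    rintro rfl
    exact prio.not_gt.2 hz.2 hyx
  calc M.eRk (insert y (↑(matroidChoose M prio q Y) \ {x}))
      ≤ M.eRk ((↑Y ∩ {z | prio.ge z y}) ∪ (↑(greedy M prio Y) \ {x})) := M.eRk_mono hsub
    _ = M.eRk ((↑(greedy M prio Y) ∩ {z | prio.ge z y}) ∪ (↑(greedy M prio Y) \ {x})) :=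
        (hbasis.eRk_eq_eRk_union _).symm
    _ ≤ ((greedy M prio Y).erase x).card := by
        rw [← Set.encard_coe_eq_coe_finsetCard]
        exact (M.eRk_mono hunion).trans (M.eRk_le_encard _)
    _ < (greedy M prio Y).card := by exact_mod_cast Finset.card_erase_lt_of_mem hxG
    _ = M.eRk (matroidChoose M prio q Y) := by
        rw [eRk_matroidChoose prio, eRk_eq_card_greedy prio]

/-- The properties of the corollary for a single institution: `X` are its contracts and `Y` are
the contracts whose agents weakly prefer them to their assignments. -/
structure MeetsObjectives (M : Matroid T) (prio : LinPref T) (q : ℕ) (Y X : Finset T) : Prop where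
  card_le : X.card ≤ q
  card_eq : ∀ y ∈ Y, y ∉ X → X.card = q
  exchange_lt : ∀ x ∈ X, ∀ y ∈ Y, y ∉ X → prio.gt y x → M.eRk (insert y (↑X \ {x})) < M.eRk X
  eRk_insert : ∀ y ∈ Y, y ∉ X → M.eRk (insert y ↑X) = M.eRk X

variable {prio}

theorem meetsObjectives_matroidChoose (hq : ∀ Y : Finset T, M.Indep Y → Y.card ≤ q)
    (Y : Finset T) : MeetsObjectives M prio q Y (matroidChoose M prio q Y) where
  card_le := (card_matroidChoose prio hq Y).trans_le (min_le_left _ _)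
  card_eq y hy hy' := by
    have hlt := Finset.card_lt_card ⟨matroidChoose_subset prio Y, fun h => hy' (h hy)⟩
    have hcard := card_matroidChoose prio hq Y
    omega
  exchange_lt _ hx _ hy hy' hyx := eRk_exchange_matroidChoose_lt prio hx hy hy' hyx
  eRk_insert y hy _ := by
    refine le_antisymm ?_ (M.eRk_mono (Set.subset_insert _ _))
    rw [eRk_matroidChoose]
    exact M.eRk_mono (Set.insert_subset hy (Finset.coe_subset.2 (matroidChoose_subset prio Y)))

namespace MeetsObjectives

variable {X Y : Finset T}

theorem card_eq_min (h : MeetsObjectives M prio q Y X) (hXY : X ⊆ Y) :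
    X.card = min q Y.card := by
  have hcard := Finset.card_le_card hXY
  by_cases hYX : Y ⊆ X
  · have hle := h.card_le
    have hge := Finset.card_le_card hYX
    omega
  · obtain ⟨y, hy, hyX⟩ := Finset.not_subset.1 hYX
    have heq := h.card_eq y hy hyX
    omega

theorem closure_eq_closure (h : MeetsObjectives M prio q Y X) (hXY : X ⊆ Y) :
    M.closure X = M.closure Y :=
  (M.isRkFinite_of_finite X.finite_toSet).closure_eq_closure_of_subset_of_forall_insert
    (Finset.coe_subset.2 hXY) fun y hy => (h.eRk_insert y hy.1 hy.2).le

theorem greedy_subset (h : MeetsObjectives M prio q Y X) (hXY : X ⊆ Y) :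
    greedy M prio Y ⊆ X := by
  intro y hy
  by_contra hyX
  have hyY := MatroidDA.greedy_subset M prio Y hy
  obtain ⟨hyE, hycl⟩ := (mem_greedy_iff prio hyY).1 hy
  have hspan : y ∈ M.closure X := h.closure_eq_closure hXY ▸ M.mem_closure_of_mem' hyY hyE
  have hspan' : y ∉ M.closure (↑X ∩ {x | prio.gt x y}) := fun hmem => hycl
    (M.closure_subset_closure (Set.inter_subset_inter_left _ (Finset.coe_subset.2 hXY)) hmem)
  obtain ⟨x, hx, hxy, hle⟩ := exists_eRk_le_eRk_exchange hyX hspan hspan'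
  have hyx : prio.gt y x := ⟨prio.not_gt.1 hxy, fun hyx => hyX (hyx ▸ hx)⟩
  exact (h.exchange_lt x hx y hyY hyX hyx).not_ge hle

theorem gt_of_notMem_greedy (h : MeetsObjectives M prio q Y X) (hXY : X ⊆ Y) {x y : T}
    (hx : x ∈ X) (hxG : x ∉ greedy M prio Y) (hy : y ∈ Y) (hyX : y ∉ X) : prio.gt x y := by
  refine ⟨prio.not_gt.1 fun hyx => (h.exchange_lt x hx y hy hyX hyx).not_ge ?_,
    fun hxy => hyX (hxy ▸ hx)⟩
  have hsub : (greedy M prio Y : Set T) ⊆ insert y (↑X \ {x}) := fun z hz =>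
    Or.inr ⟨h.greedy_subset hXY hz, fun hzx => hxG (hzx ▸ hz)⟩
  calc M.eRk X ≤ M.eRk Y := M.eRk_mono (Finset.coe_subset.2 hXY)
    _ = M.eRk (greedy M prio Y) := (greedy_isBasis' prio Y).eRk_eq_eRk.symm
    _ ≤ M.eRk (insert y (↑X \ {x})) := M.eRk_mono hsub

end MeetsObjectives

theorem matroidChoose_eq_iff (hq : ∀ Y : Finset T, M.Indep Y → Y.card ≤ q) {X Y : Finset T}
    (hXY : X ⊆ Y) : matroidChoose M prio q Y = X ↔ MeetsObjectives M prio q Y X := by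
  refine ⟨fun h => h ▸ meetsObjectives_matroidChoose hq Y, fun h => ?_⟩
  have hGX := h.greedy_subset hXY
  have hcard : (X \ greedy M prio Y).card =
      min (q - (greedy M prio Y).card) (Y \ greedy M prio Y).card := by
    have hG := hq _ (greedy_indep prio Y)
    have hX := h.card_eq_min hXY
    have hXG := Finset.card_sdiff_add_card_eq_card hGX
    have hYG := Finset.card_sdiff_add_card_eq_card (greedy_subset M prio Y)
    omega
  rw [matroidChoose_eq_greedy_union_top,
    prio.top_eq (Finset.sdiff_subset_sdiff hXY (Finset.Subset.refl _)) hcard,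
    Finset.union_sdiff_of_subset hGX]
  intro x hx y hy hyX
  obtain ⟨hx, hxG⟩ := Finset.mem_sdiff.1 hx
  obtain ⟨hy, hyG⟩ := Finset.mem_sdiff.1 hy
  exact h.gt_of_notMem_greedy hXY hx hxG hy fun hX => hyX (Finset.mem_sdiff.2 ⟨hX, hyG⟩)

end MatroidChoice

section ChoiceRules

variable {T : Type*} {C : ChoiceRule T}

/-- Path independence of a choice rule, in its Aizerman–Malishevski form: the substitutes condition
together with the irrelevance of rejected contracts. -/
structure ChoiceRule.PathIndependent (C : ChoiceRule T) : Prop where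
  mem_choose_of_subset : ∀ ⦃Y Y' : Finset T⦄, Y ⊆ Y' → ∀ x ∈ Y, x ∈ C.choose Y' → x ∈ C.choose Y
  choose_eq : ∀ ⦃Y Y' : Finset T⦄, C.choose Y' ⊆ Y → Y ⊆ Y' → C.choose Y = C.choose Y'

/-- The law of aggregate demand of a choice rule: at least as many contracts are chosen
from larger choice problems. -/
def ChoiceRule.LawOfAggregateDemand (C : ChoiceRule T) : Prop :=
  ∀ ⦃Y Y' : Finset T⦄, Y ⊆ Y' → (C.choose Y).card ≤ (C.choose Y').card

theorem ChoiceRule.LawOfAggregateDemand.pathIndependent (hD : C.LawOfAggregateDemand)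
    (hC : ∀ ⦃Y Y' : Finset T⦄, Y ⊆ Y' → ∀ x ∈ Y, x ∈ C.choose Y' → x ∈ C.choose Y) :
    C.PathIndependent where
  mem_choose_of_subset := hC
  choose_eq _ _ hY hY' :=
    (Finset.eq_of_subset_of_card_le (fun x hx => hC hY' x (hY hx) hx) (hD hY')).symm

theorem ChoiceRule.PathIndependent.choose_choose_union (hC : C.PathIndependent) (Y Z : Finset T) :
    C.choose (C.choose Y ∪ Z) = C.choose (Y ∪ Z) := by
  refine hC.choose_eq (fun x hx => ?_)
    (Finset.union_subset_union (C.choose_subset Y) (Finset.Subset.refl Z))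
  exact Finset.mem_union.2 ((Finset.mem_union.1 (C.choose_subset _ hx)).imp_left fun hxY =>
    hC.mem_choose_of_subset Finset.subset_union_left x hxY hx)

theorem matroidChoice_lawOfAggregateDemand {M : Matroid T} {q : ℕ} (prio : LinPref T)
    (hq : ∀ Y : Finset T, M.Indep Y → Y.card ≤ q) :
    (matroidChoice M prio q).LawOfAggregateDemand := fun Y Y' h => by
  change (matroidChoose M prio q Y).card ≤ (matroidChoose M prio q Y').card
  rw [card_matroidChoose prio hq, card_matroidChoose prio hq]
  exact min_le_min_left q (Finset.card_le_card h)

theorem matroidChoice_pathIndependent {M : Matroid T} {q : ℕ} (prio : LinPref T)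
    (hq : ∀ Y : Finset T, M.Indep Y → Y.card ≤ q) : (matroidChoice M prio q).PathIndependent :=
  (matroidChoice_lawOfAggregateDemand prio hq).pathIndependent
    fun _ _ h _ hx hx' => mem_matroidChoose_of_subset prio h hx hx'

end ChoiceRules

section Aggregate

variable {X B : Type*} {f : X → B}

theorem mem_part {Y : Finset X} {b : B} {x : ContractsOf f b} : x ∈ part f Y b ↔ x.1 ∈ Y :=
  Finset.mem_subtype

theorem part_mono {Y Y' : Finset X} (h : Y ⊆ Y') (b : B) : part f Y b ⊆ part f Y' b :=
  fun _ hx => mem_part.2 (h (mem_part.1 hx))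

theorem eq_iff_part_eq {Y Y' : Finset X} : Y = Y' ↔ ∀ b, part f Y b = part f Y' b := by
  refine ⟨fun h b => by rw [h], fun h => Finset.ext fun x => ?_⟩
  rw [← mem_part (f := f) (x := ⟨x, rfl⟩), h, mem_part]

theorem card_eq_sum_card_part {Y S : Finset X} (h : Y ⊆ S) :
    Y.card = ∑ b ∈ S.image f, (part f Y b).card := by
  rw [Finset.card_eq_sum_card_fiberwise fun x hx => Finset.mem_image_of_mem f (h hx)]
  exact Finset.sum_congr rfl fun b _ => (Finset.card_subtype _ Y).symm

variable (C : (b : B) → ChoiceRule (ContractsOf f b))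

theorem mem_accepted {Y : Finset X} {b : B} {x : ContractsOf f b} :
    x.1 ∈ accepted C Y ↔ x ∈ (C b).choose (part f Y b) := by
  obtain ⟨x, rfl⟩ := x
  exact Finset.mem_filter.trans
    (and_iff_right_of_imp fun hx => mem_part.1 ((C (f x)).choose_subset _ hx))

theorem part_accepted (Y : Finset X) (b : B) :
    part f (accepted C Y) b = (C b).choose (part f Y b) :=
  Finset.ext fun _ => mem_part.trans (mem_accepted C)

/-- The joint choice rule of all institutions, on the set of all contracts. -/
def aggregate : ChoiceRule X where
  choose := accepted C
  choose_subset Y := Finset.filter_subset _ Y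

variable {C}

theorem aggregate_pathIndependent (hC : ∀ b, (C b).PathIndependent) :
    (aggregate C).PathIndependent where
  mem_choose_of_subset Y Y' h x hx hx' := (mem_accepted C (x := ⟨x, rfl⟩)).2
    ((hC _).mem_choose_of_subset (part_mono h _) _ (mem_part.2 hx) ((mem_accepted C).1 hx'))
  choose_eq Y Y' hY hY' := eq_iff_part_eq.2 fun b => by
    change part f (accepted C Y) b = part f (accepted C Y') b
    rw [part_accepted, part_accepted]
    refine (hC b).choose_eq ?_ (part_mono hY' b)
    rw [← part_accepted]
    exact part_mono hY b

theorem aggregate_lawOfAggregateDemand (hC : ∀ b, (C b).LawOfAggregateDemand) :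
    (aggregate C).LawOfAggregateDemand := fun Y Y' h => by
  rw [card_eq_sum_card_part (f := f) (((aggregate C).choose_subset Y).trans h),
    card_eq_sum_card_part (f := f) ((aggregate C).choose_subset Y')]
  refine Finset.sum_le_sum fun b _ => ?_
  change (part f (accepted C Y) b).card ≤ (part f (accepted C Y') b).card
  rw [part_accepted, part_accepted]
  exact hC b (part_mono h b)

end Aggregate

section Assignment

variable {A X : Type*} {agent : X → A} (Z : Matching agent)

theorem Matching.assignment_eq_some_iff {a : A} {x : ContractsOf agent a} :
    Z.assignment a = some x ↔ x.1 ∈ Z.contracts := by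
  unfold Matching.assignment
  split_ifs with h
  · refine Option.some_inj.trans ⟨fun hx => hx ▸ h.choose_spec, fun hx => Subtype.ext ?_⟩
    exact (part_card_le_one_iff _ _).1 (Z.card_le_one a) _ h.choose_spec _ hx h.choose.2 x.2
  · exact iff_of_false nofun fun hx => h ⟨x, hx⟩

theorem Matching.ext_assignment {Z Z' : Matching agent}
    (h : ∀ a, Z.assignment a = Z'.assignment a) : Z = Z' := by
  have hcontracts : Z.contracts = Z'.contracts := Finset.ext fun x => by
    rw [← Z.assignment_eq_some_iff (x := ⟨x, rfl⟩), h, Z'.assignment_eq_some_iff]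
  cases Z
  cases Z'
  cases hcontracts
  rfl

theorem Matching.card_image_agent : (Z.contracts.image agent).card = Z.contracts.card :=
  Finset.card_image_of_injOn fun x hx y hy hxy =>
    (part_card_le_one_iff _ _).1 (Z.card_le_one (agent y)) x hx y hy hxy rfl

theorem Matching.mem_image_agent {a : A} :
    a ∈ Z.contracts.image agent ↔ Z.assignment a ≠ none := by
  rw [Option.ne_none_iff_exists', Finset.mem_image]
  exact ⟨fun ⟨x, hx, hxa⟩ => ⟨⟨x, hxa⟩, Z.assignment_eq_some_iff.2 hx⟩,
    fun ⟨x, hx⟩ => ⟨x.1, Z.assignment_eq_some_iff.1 hx, x.2⟩⟩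

end Assignment

section Stability

variable {A I X : Type*} [Fintype X] {agent : X → A} {inst : X → I}

/-- The contracts that their agents weakly prefer to their assignments in `Z`. -/
def weakUpper (R : Problem agent) (Z : Matching agent) : Finset X :=
  Finset.univ.filter fun x => (R (agent x)).ge (some ⟨x, rfl⟩) (Z.assignment (agent x))

variable {R R' : Problem agent} {Z Z' : Matching agent}

theorem mem_weakUpper {a : A} {x : ContractsOf agent a} :
    x.1 ∈ weakUpper R Z ↔ (R a).ge (some x) (Z.assignment a) := by
  obtain ⟨x, rfl⟩ := x
  simp [weakUpper]

theorem contracts_subset_weakUpper (R : Problem agent) (Z : Matching agent) :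
    Z.contracts ⊆ weakUpper R Z := fun x hx => by
  rw [mem_weakUpper (x := ⟨x, rfl⟩), (Z.assignment_eq_some_iff (x := ⟨x, rfl⟩)).2 hx]
  exact (R _).ge_refl _

theorem weakUpper_subset (h : ∀ a (x : ContractsOf agent a), (R a).ge (some x) (Z.assignment a) →
    (R' a).ge (some x) (Z'.assignment a)) : weakUpper R Z ⊆ weakUpper R' Z' := fun x hx =>
  (mem_weakUpper (x := ⟨x, rfl⟩)).2 (h _ _ (mem_weakUpper.1 hx))

theorem prefers_iff {x : X} : Prefers R Z x ↔ x ∈ weakUpper R Z ∧ x ∉ Z.contracts := by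
  rw [mem_weakUpper (x := ⟨x, rfl⟩), Prefers, LinPref.gt, ne_comm, Ne, Z.assignment_eq_some_iff]

/-- Stability of a matching: individual rationality, and the institutions choose their contracts
when all the contracts that are weakly preferred to the matching are available. -/
structure Stable (C : (i : I) → ChoiceRule (ContractsOf inst i)) (R : Problem agent)
    (Z : Matching agent) : Prop where
  individuallyRational : IndividuallyRational R Z
  accepted_eq : accepted C (weakUpper R Z) = Z.contracts

variable {C : (i : I) → ChoiceRule (ContractsOf inst i)}

theorem Stable.update_of_ge (hC : (aggregate C).PathIndependent) {a : A}
    {P Q : LinPref (Option (ContractsOf agent a))} (hZ : Stable C (Function.update R a P) Z)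
    (hnone : Q.ge (Z.assignment a) none)
    (hupper : ∀ x, Q.ge (some x) (Z.assignment a) → P.ge (some x) (Z.assignment a)) :
    Stable C (Function.update R a Q) Z where
  individuallyRational b := by
    rcases eq_or_ne b a with rfl | hb
    · rwa [Function.update_self]
    · simpa only [Function.update_of_ne hb] using hZ.individuallyRational b
  accepted_eq := by
    have hsub : weakUpper (Function.update R a Q) Z ⊆ weakUpper (Function.update R a P) Z := by
      refine weakUpper_subset fun b x hx => ?_
      rcases eq_or_ne b a with rfl | hb
      · rw [Function.update_self] at hx ⊢
        exact hupper x hx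
      · rwa [Function.update_of_ne hb] at hx ⊢
    refine (hC.choose_eq ?_ hsub).trans hZ.accepted_eq
    exact hZ.accepted_eq.trans_subset (contracts_subset_weakUpper _ Z)

end Stability

section DeferredAcceptance

variable {A I X : Type*} {agent : X → A} {inst : X → I}

/-- Every option that agent `a` strictly prefers to `u` is a contract in `F`. In particular, the
null contract is not preferred to `u`. -/
def RejectedAbove (R : Problem agent) (F : Finset X) (a : A)
    (u : Option (ContractsOf agent a)) : Prop :=
  ∀ v, (R a).gt v u → ∃ y, v = some y ∧ y.1 ∈ F

variable {R : Problem agent} {a : A} {u v : Option (ContractsOf agent a)} {F F' : Finset X}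
  {Z : Matching agent}

theorem RejectedAbove.mono (hu : RejectedAbove R F a u) (h : F ⊆ F') : RejectedAbove R F' a u :=
  fun v hv => (hu v hv).imp fun _ hy => ⟨hy.1, h hy.2⟩

theorem RejectedAbove.ge (hu : RejectedAbove R F a u) (hv : ∀ y, v = some y → y.1 ∉ F) :
    (R a).ge u v := by
  by_contra hge
  obtain ⟨y, hy, hyF⟩ := hu v ((R a).not_ge.1 hge)
  exact hv y hy hyF

theorem RejectedAbove.ge_assignment (hu : RejectedAbove R F a u) (hZ : Disjoint Z.contracts F) :
    (R a).ge u (Z.assignment a) :=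
  hu.ge fun _ hy => Finset.disjoint_left.1 hZ (Z.assignment_eq_some_iff.1 hy)

theorem exists_rejectedAbove [Finite X] (R : Problem agent) (F : Finset X) (a : A) :
    ∃ u, (∀ x, u = some x → x.1 ∉ F) ∧ RejectedAbove R F a u := by
  have := Fintype.ofFinite X
  obtain ⟨u, hu, hbest⟩ := (R a).exists_forall_ge
    (S := Finset.univ.filter fun u : Option (ContractsOf agent a) => ∀ x, u = some x → x.1 ∉ F)
    ⟨none, by simp⟩
  refine ⟨u, (Finset.mem_filter.1 hu).2, fun v hv => ?_⟩
  by_contra! hvF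
  exact (R a).not_ge.2 hv (hbest v (Finset.mem_filter.2 ⟨Finset.mem_univ v, hvF⟩))

variable [Fintype X]

theorem subset_weakUpper {Y : Finset X}
    (hY : ∀ a (x : ContractsOf agent a), x.1 ∈ Y → RejectedAbove R F a (some x))
    (hZ : Disjoint Z.contracts F) : Y ⊆ weakUpper R Z := fun x hx =>
  (mem_weakUpper (x := ⟨x, rfl⟩)).2 ((hY _ _ hx).ge_assignment hZ)

theorem mem_newProposals {s : DAState X} {x : ContractsOf agent a} :
    x.1 ∈ newProposals R s ↔ (∀ y ∈ s.held, agent y ≠ a) ∧ x.1 ∉ s.rejected ∧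
      RejectedAbove R s.rejected a (some x) := by
  obtain ⟨x, rfl⟩ := x
  refine Finset.mem_filter.trans <| (and_iff_right (Finset.mem_univ x)).trans <|
    and_congr_right fun _ => and_congr_right fun _ => ⟨fun ⟨hnone, hsome⟩ v hv => ?_,
      fun hx => ⟨hx.ge (by simp), fun y hy => hx.ge fun z hz => ?_⟩⟩
  · rw [← LinPref.not_ge] at hv
    cases v with
    | none => exact absurd hnone hv
    | some y => exact ⟨y, rfl, by_contra fun hy => hv (hsome y hy)⟩
  · rwa [← Option.some_inj.1 hz]

/-- The invariant of the deferred-acceptance algorithm: agents propose in the order of their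
preferences, the institutions hold what they would choose from all the proposals made so far, and
no contract of a stable matching has been rejected. -/
structure DAInvariant (C : (i : I) → ChoiceRule (ContractsOf inst i)) (R : Problem agent)
    (s : DAState X) : Prop where
  disjoint : Disjoint s.held s.rejected
  accepted_eq : accepted C (s.held ∪ s.rejected) = s.held
  rejectedAbove : ∀ a (x : ContractsOf agent a), x.1 ∈ s.held ∪ s.rejected →
    RejectedAbove R s.rejected a (some x)
  disjoint_of_stable : ∀ Z : Matching agent, Stable C R Z → Disjoint Z.contracts s.rejected

variable {C : (i : I) → ChoiceRule (ContractsOf inst i)} {s : DAState X}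

theorem daStep_held_union_rejected (C : (i : I) → ChoiceRule (ContractsOf inst i))
    (R : Problem agent) (s : DAState X) :
    (daStep C R s).held ∪ (daStep C R s).rejected = considered R s ∪ s.rejected := by
  have hsub : accepted C (considered R s) ⊆ considered R s := (aggregate C).choose_subset _
  change accepted C (considered R s) ∪
    (s.rejected ∪ (considered R s \ accepted C (considered R s))) = _
  rw [Finset.union_left_comm, Finset.union_sdiff_of_subset hsub, Finset.union_comm]

namespace DAInvariant

theorem initial (C : (i : I) → ChoiceRule (ContractsOf inst i)) (R : Problem agent) :
    DAInvariant C R ⟨∅, ∅⟩ where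
  disjoint := by simp
  accepted_eq := by simp [accepted]
  rejectedAbove := by simp
  disjoint_of_stable := by simp

variable (hs : DAInvariant C R s)
include hs

theorem disjoint_considered : Disjoint (considered R s) s.rejected :=
  Finset.disjoint_union_left.2 ⟨hs.disjoint, Finset.disjoint_left.2 fun x hx =>
    ((mem_newProposals (x := ⟨x, rfl⟩)).1 hx).2.1⟩

theorem rejectedAbove_considered {x : ContractsOf agent a}
    (hx : x.1 ∈ considered R s ∪ s.rejected) : RejectedAbove R s.rejected a (some x) := by
  rw [considered, Finset.union_right_comm, Finset.mem_union] at hx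
  exact hx.elim (hs.rejectedAbove a x) fun hx => (mem_newProposals.1 hx).2.2

theorem accepted_considered_union_rejected (hC : (aggregate C).PathIndependent) :
    accepted C (considered R s ∪ s.rejected) = accepted C (considered R s) := by
  have hunion : accepted C (accepted C (s.held ∪ s.rejected) ∪ newProposals R s) =
      accepted C (s.held ∪ s.rejected ∪ newProposals R s) := hC.choose_choose_union _ _
  rw [considered, Finset.union_right_comm, ← hunion, hs.accepted_eq]

theorem disjoint_daStep_of_stable (hC : (aggregate C).PathIndependent) {Z : Matching agent}
    (hZ : Stable C R Z) : Disjoint Z.contracts (daStep C R s).rejected := by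
  have hdisj := hs.disjoint_of_stable Z hZ
  refine Finset.disjoint_union_right.2 ⟨hdisj, Finset.disjoint_left.2 fun z hz hzrej => ?_⟩
  obtain ⟨hzcons, hznot⟩ := Finset.mem_sdiff.1 hzrej
  have hsub := subset_weakUpper (fun _ _ => hs.rejectedAbove_considered) hdisj
  rw [← hZ.accepted_eq] at hz
  rw [← hs.accepted_considered_union_rejected hC] at hznot
  exact hznot (hC.mem_choose_of_subset hsub z (Finset.mem_union_left _ hzcons) hz)

theorem daStep (hC : (aggregate C).PathIndependent) : DAInvariant C R (daStep C R s) where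
  disjoint := Finset.disjoint_union_right.2
    ⟨Finset.disjoint_of_subset_left ((aggregate C).choose_subset _) hs.disjoint_considered,
      Finset.disjoint_sdiff⟩
  accepted_eq := by
    rw [daStep_held_union_rejected, hs.accepted_considered_union_rejected hC, MatroidDA.daStep]
  rejectedAbove a x hx := by
    rw [daStep_held_union_rejected] at hx
    exact (hs.rejectedAbove_considered hx).mono Finset.subset_union_left
  disjoint_of_stable _ hZ := hs.disjoint_daStep_of_stable hC hZ

theorem daStep_held_eq_considered (hfinal : (MatroidDA.daStep C R s).rejected = s.rejected) :
    (MatroidDA.daStep C R s).held = considered R s := by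
  refine ((aggregate C).choose_subset _).antisymm (Finset.sdiff_eq_empty_iff_subset.1 ?_)
  exact (Finset.disjoint_of_subset_left Finset.sdiff_subset hs.disjoint_considered).eq_bot_of_le
    (Finset.union_eq_left.1 hfinal)

theorem rejectedAbove_assignment {Z : Matching agent} (hZ : Z.contracts = considered R s) (a : A) :
    RejectedAbove R s.rejected a (Z.assignment a) := by
  cases hassign : Z.assignment a with
  | some x =>
    rw [Z.assignment_eq_some_iff, hZ] at hassign
    exact hs.rejectedAbove_considered (Finset.mem_union_left _ hassign)
  | none =>
    have hunmatched : ∀ y ∈ considered R s, agent y ≠ a := fun y hy hya =>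
      Z.mem_image_agent.1 (Finset.mem_image.2 ⟨y, hZ ▸ hy, hya⟩) hassign
    obtain ⟨u, hu, habove⟩ := exists_rejectedAbove R s.rejected a
    cases u with
    | none => exact habove
    | some x =>
      have hx : x.1 ∈ newProposals R s := mem_newProposals.2
        ⟨fun y hy => hunmatched y (Finset.mem_union_left _ hy), hu x rfl, habove⟩
      exact absurd x.2 (hunmatched x.1 (Finset.mem_union_right _ hx))

theorem exists_daRun_eq (hC : (aggregate C).PathIndependent) :
    ∃ t, DAInvariant C R t ∧ (MatroidDA.daStep C R t).rejected = t.rejected ∧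
      daRun C R s = (MatroidDA.daStep C R t).held := by
  induction s using daRun.induct C R with
  | case1 s hfinal => exact ⟨s, hs, hfinal, by rw [daRun, if_pos hfinal]⟩
  | case2 s hstep ih =>
    rw [daRun, if_neg hstep]
    exact ih (hs.daStep hC)

end DAInvariant

theorem exists_daRule_eq_held (hC : (aggregate C).PathIndependent) (R : Problem agent) :
    ∃ t, DAInvariant C R t ∧ (daRule C R).contracts = t.held ∧
      ∀ a, RejectedAbove R t.rejected a ((daRule C R).assignment a) := by
  obtain ⟨t, ht, hfinal, hrun⟩ := (DAInvariant.initial C R).exists_daRun_eq hC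
  refine ⟨daStep C R t, ht.daStep hC, hrun, ?_⟩
  rw [hfinal]
  exact ht.rejectedAbove_assignment (hrun.trans (ht.daStep_held_eq_considered hfinal))

theorem daRule_stable (hC : (aggregate C).PathIndependent) (R : Problem agent) :
    Stable C R (daRule C R) := by
  obtain ⟨t, ht, hheld, habove⟩ := exists_daRule_eq_held hC R
  refine ⟨fun a => (habove a).ge (by simp), ?_⟩
  have hsub : weakUpper R (daRule C R) ⊆ t.held ∪ t.rejected := fun x hx => by
    by_cases hxmem : x ∈ (daRule C R).contracts
    · exact Finset.mem_union_left _ (hheld ▸ hxmem)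
    · obtain ⟨y, hxy, hy⟩ := habove _ _ (prefers_iff.2 ⟨hx, hxmem⟩)
      rw [← Option.some_inj.1 hxy] at hy
      exact Finset.mem_union_right _ hy
  have hacc : accepted C (t.held ∪ t.rejected) = (daRule C R).contracts :=
    ht.accepted_eq.trans hheld.symm
  exact (hC.choose_eq (hacc.trans_subset (contracts_subset_weakUpper R _)) hsub).trans hacc

theorem daRule_optimal (hC : (aggregate C).PathIndependent) (hZ : Stable C R Z) (a : A) :
    (R a).ge ((daRule C R).assignment a) (Z.assignment a) := by
  obtain ⟨t, ht, -, habove⟩ := exists_daRule_eq_held hC R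
  exact (habove a).ge_assignment (ht.disjoint_of_stable Z hZ)

end DeferredAcceptance

section RuralHospitals

variable {A I X : Type*} [Fintype X] {agent : X → A} {inst : X → I} {R : Problem agent}
  {Z Z' : Matching agent} {C : (i : I) → ChoiceRule (ContractsOf inst i)}

theorem Stable.assignment_eq_none_iff_daRule (hC : (aggregate C).PathIndependent)
    (hD : (aggregate C).LawOfAggregateDemand) (hZ : Stable C R Z) (a : A) :
    Z.assignment a = none ↔ (daRule C R).assignment a = none := by
  have hagents : Z.contracts.image agent ⊆ (daRule C R).contracts.image agent := fun b hb => by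
    rw [Matching.mem_image_agent] at hb ⊢
    intro hnone
    have hopt := daRule_optimal hC hZ b
    rw [hnone] at hopt
    exact hb ((R b).ge_antisymm (hZ.individuallyRational b) hopt)
  have hcard : (daRule C R).contracts.card ≤ Z.contracts.card := by
    rw [← hZ.accepted_eq, ← (daRule_stable hC R).accepted_eq]
    exact hD (weakUpper_subset fun b _ hx => (R b).ge_trans hx (daRule_optimal hC hZ b))
  have heq := Finset.eq_of_subset_of_card_le hagents
    (by rwa [Matching.card_image_agent, Matching.card_image_agent])
  rw [← not_iff_not, ← Ne, ← Ne, ← Matching.mem_image_agent, ← Matching.mem_image_agent, heq]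

theorem Stable.assignment_eq_none_iff (hC : (aggregate C).PathIndependent)
    (hD : (aggregate C).LawOfAggregateDemand) (hZ : Stable C R Z) (hZ' : Stable C R Z') (a : A) :
    Z.assignment a = none ↔ Z'.assignment a = none :=
  (hZ.assignment_eq_none_iff_daRule hC hD a).trans
    (hZ'.assignment_eq_none_iff_daRule hC hD a).symm

end RuralHospitals

section Restrict

variable {T : Type*}

/-- The acceptability class of an option when exactly the contracts in `K` are acceptable; lower
classes are better. -/
def restrictClass (K : Set T) : Option T → ℕ
  | none => 1
  | some x => if x ∈ K then 0 else 2

/-- The preference obtained from `R` by making exactly the contracts in `K` acceptable, without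
changing the order within `K` and outside `K`. Agents misreport in this way in the arguments about
strategy-proofness. -/
def LinPref.restrict (R : LinPref (Option T)) (K : Set T) : LinPref (Option T) where
  ge u v := restrictClass K u < restrictClass K v ∨
    restrictClass K u = restrictClass K v ∧ R.ge u v
  linear :=
    { refl u := Or.inr ⟨rfl, R.ge_refl u⟩
      trans u v w := by
        have := R.ge_trans (x := u) (y := v) (z := w)
        grind
      antisymm u v := by
        have := R.ge_antisymm (x := u) (y := v)
        grind
      total u v := by
        have := R.linear.total u v
        grind }

variable (R : LinPref (Option T)) {K : Set T} {x y : T}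

theorem LinPref.restrict_ge_none : (R.restrict K).ge (some x) none ↔ x ∈ K := by
  by_cases h : x ∈ K <;> simp [LinPref.restrict, restrictClass, h]

theorem LinPref.restrict_ge_of_mem (hx : x ∈ K) :
    (R.restrict K).ge (some y) (some x) ↔ y ∈ K ∧ R.ge (some y) (some x) := by
  by_cases h : y ∈ K <;> simp [LinPref.restrict, restrictClass, h, hx]

end Restrict

section StrategyProofness

variable {A I X : Type*} [Fintype X] {agent : X → A} {inst : X → I} {R : Problem agent}
  {Z W : Matching agent} {C : (i : I) → ChoiceRule (ContractsOf inst i)}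

/- If the agent were unmatched in `W`, then `Z` and `W` would both be stable when the agent accepts
only `x`, contrary to the rural hospitals theorem. -/
theorem Stable.exists_assignment_mem_of_restrict (hC : (aggregate C).PathIndependent)
    (hD : (aggregate C).LawOfAggregateDemand) {a : A}
    {P Q : LinPref (Option (ContractsOf agent a))} {K : Set (ContractsOf agent a)}
    {x : ContractsOf agent a} (hx : x ∈ K) (hZ : Stable C (Function.update R a P) Z)
    (hZx : Z.assignment a = some x) (hW : Stable C (Function.update R a (Q.restrict K)) W) :
    ∃ w ∈ K, W.assignment a = some w := by
  cases hWa : W.assignment a with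
  | some w =>
    have hir := hW.individuallyRational a
    rw [hWa, Function.update_self, Q.restrict_ge_none] at hir
    exact ⟨w, hir, rfl⟩
  | none =>
    have hZ' : Stable C (Function.update R a (Q.restrict {x})) Z := by
      refine hZ.update_of_ge hC (hZx ▸ Q.restrict_ge_none.2 rfl) fun y hy => ?_
      rw [hZx] at hy ⊢
      obtain ⟨rfl, -⟩ := (Q.restrict_ge_of_mem (Set.mem_singleton x)).1 hy
      exact P.ge_refl _
    have hW' : Stable C (Function.update R a (Q.restrict {x})) W := by
      refine hW.update_of_ge hC (hWa ▸ (Q.restrict {x}).ge_refl none) fun y hy => ?_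
      rw [hWa, Q.restrict_ge_none] at hy ⊢
      exact Set.mem_singleton_iff.1 hy ▸ hx
    have hnone := (hZ'.assignment_eq_none_iff hC hD hW' a).2 hWa
    exact absurd (hZx.symm.trans hnone) (Option.some_ne_none x)

theorem daRule_strategyProof (hC : (aggregate C).PathIndependent)
    (hD : (aggregate C).LawOfAggregateDemand) :
    StrategyProof (daRule C : MatchingRule agent) := by
  intro R a R'
  by_contra hmanip
  have hZ := daRule_stable hC (Function.update R a R')
  set Z := daRule C (Function.update R a R')
  cases hZx : Z.assignment a with
  | none => exact hmanip (hZx ▸ (daRule_stable hC R).individuallyRational a)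
  | some x =>
    rw [hZx, LinPref.not_ge] at hmanip
    let K : Set (ContractsOf agent a) := {y | (R a).ge (some y) (some x)}
    have hW := daRule_stable hC (Function.update R a ((R a).restrict K))
    set W := daRule C (Function.update R a ((R a).restrict K))
    obtain ⟨w, hw, hWw⟩ :=
      hZ.exists_assignment_mem_of_restrict hC hD ((R a).ge_refl (some x)) hZx hW
    have hacceptable : (R a).ge (some w) none := (R a).ge_trans hw
      ((R a).ge_trans hmanip.1 ((daRule_stable hC R).individuallyRational a))
    have hWR : Stable C (Function.update R a (R a)) W := by
      refine hW.update_of_ge hC (hWw ▸ hacceptable) fun y hy => ?_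
      rw [hWw] at hy ⊢
      exact ((R a).restrict_ge_of_mem hw).2 ⟨(R a).ge_trans hy hw, hy⟩
    rw [Function.update_eq_self] at hWR
    have hopt := daRule_optimal hC hWR a
    rw [hWw] at hopt
    exact (R a).not_ge.2 hmanip ((R a).ge_trans hopt hw)

theorem eq_daRule_of_stable_of_strategyProof (hC : (aggregate C).PathIndependent)
    (hD : (aggregate C).LawOfAggregateDemand) {φ : MatchingRule agent}
    (hstable : ∀ R, Stable C R (φ R)) (hsp : StrategyProof φ) : φ = daRule C := by
  funext R
  refine Matching.ext_assignment fun a =>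
    (R a).ge_antisymm ?_ (daRule_optimal hC (hstable R) a)
  cases hDA : (daRule C R).assignment a with
  | none => exact (hstable R).individuallyRational a
  | some x =>
    let K : Set (ContractsOf agent a) := {y | (R a).ge (some y) (some x)}
    have hDAstable : Stable C (Function.update R a (R a)) (daRule C R) := by
      rw [Function.update_eq_self]
      exact daRule_stable hC R
    obtain ⟨w, hw, hφw⟩ := hDAstable.exists_assignment_mem_of_restrict hC hD
      ((R a).ge_refl (some x)) hDA (hstable (Function.update R a ((R a).restrict K)))
    have htruth := hsp R a ((R a).restrict K)
    rw [hφw] at htruth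
    exact (R a).ge_trans htruth hw

end StrategyProofness

section Characterization

variable {A I X : Type*} [Fintype X] {agent : X → A} {inst : X → I} {q : I → ℕ}
  {M : (i : I) → Matroid (ContractsOf inst i)} {prio : (i : I) → LinPref (ContractsOf inst i)}

theorem forall_meetsObjectives_iff {R : Problem agent} {Z : Matching agent} :
    (∀ i, MeetsObjectives (M i) (prio i) (q i) (part inst (weakUpper R Z) i)
      (part inst Z.contracts i)) ↔
    NonWasteful inst q R Z ∧ NoJustifiedEnvyUnderRank inst M prio R Z ∧
      MatroidalObjectives inst M R Z := by
  rw [NonWasteful, NoJustifiedEnvyUnderRank, MatroidalObjectives, ← forall_and, ← forall_and]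
  simp only [prefers_iff, Finset.coe_insert, Finset.coe_erase]
  refine forall_congr' fun i => ⟨fun h => ⟨⟨h.card_le, fun x hx => ?_⟩, fun x hx y hy hpref => ?_,
    fun y hy hpref => ?_⟩, fun ⟨⟨hle, heq⟩, hlt, hins⟩ => ⟨hle, fun y hy hyZ => ?_,
      fun x hx y hy hyZ => ?_, fun y hy hyZ => ?_⟩⟩
  · exact h.card_eq x (mem_part.2 hx.1) fun hxZ => hx.2 (mem_part.1 hxZ)
  · exact h.exchange_lt x hx y (mem_part.2 hpref.1) hy
  · exact h.eRk_insert y (mem_part.2 hpref.1) hy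
  · exact heq y ⟨mem_part.1 hy, fun hyZ' => hyZ (mem_part.2 hyZ')⟩
  · exact hlt x hx y hyZ ⟨mem_part.1 hy, fun hyZ' => hyZ (mem_part.2 hyZ')⟩
  · exact hins y hyZ ⟨mem_part.1 hy, fun hyZ' => hyZ (mem_part.2 hyZ')⟩

theorem stable_matroidChoice_iff
    (hq : ∀ i, ∀ Y : Finset (ContractsOf inst i), (M i).Indep Y → Y.card ≤ q i)
    (R : Problem agent) (Z : Matching agent) :
    Stable (fun i => matroidChoice (M i) (prio i) (q i)) R Z ↔
      NonWasteful inst q R Z ∧ NoJustifiedEnvyUnderRank inst M prio R Z ∧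
        MatroidalObjectives inst M R Z ∧ IndividuallyRational R Z := by
  have haccepted : accepted (fun i => matroidChoice (M i) (prio i) (q i)) (weakUpper R Z) =
      Z.contracts ↔ NonWasteful inst q R Z ∧ NoJustifiedEnvyUnderRank inst M prio R Z ∧
        MatroidalObjectives inst M R Z := by
    rw [eq_iff_part_eq (f := inst), ← forall_meetsObjectives_iff]
    refine forall_congr' fun i => ?_
    rw [part_accepted]
    exact matroidChoose_eq_iff (hq i) (part_mono (contracts_subset_weakUpper R Z) i)
  exact ⟨fun ⟨hir, hacc⟩ => have ⟨hnw, hnje, hmo⟩ := haccepted.1 hacc; ⟨hnw, hnje, hmo, hir⟩,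
    fun ⟨hnw, hnje, hmo, hir⟩ => ⟨hir, haccepted.2 ⟨hnw, hnje, hmo⟩⟩⟩

end Characterization

end

end MatroidDA

theorem mainTheorem5 {A I X : Type*} [Fintype X] (agent : X → A) (inst : X → I)
    (q : I → ℕ)
    (M : (i : I) → Matroid (ContractsOf inst i))
    (hE : ∀ i, (M i).E = Set.univ)
    (hq : ∀ i, ∀ Y : Finset (ContractsOf inst i), (M i).Indep Y → Y.card ≤ q i)
    (prio : (i : I) → LinPref (ContractsOf inst i))
    (φ : MatchingRule agent) :
    ((∀ R, NonWasteful inst q R (φ R)) ∧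
      (∀ R, NoJustifiedEnvyUnderRank inst M prio R (φ R)) ∧
      (∀ R, MatroidalObjectives inst M R (φ R)) ∧
      (∀ R, IndividuallyRational R (φ R)) ∧
      StrategyProof φ) ↔
    φ = daRule (fun i => matroidChoice (M i) (prio i) (q i)) := by
  have hC := aggregate_pathIndependent fun i => matroidChoice_pathIndependent (prio i) (hq i)
  have hD := aggregate_lawOfAggregateDemand fun i =>
    matroidChoice_lawOfAggregateDemand (prio i) (hq i)
  constructor
  · rintro ⟨hnw, hnje, hmo, hir, hsp⟩
    exact eq_daRule_of_stable_of_strategyProof hC hD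
      (fun R => (stable_matroidChoice_iff hq R _).2 ⟨hnw R, hnje R, hmo R, hir R⟩) hsp
  · rintro rfl
    have h := fun R : Problem agent =>
      (stable_matroidChoice_iff hq R _).1 (daRule_stable hC R)
    exact ⟨fun R => (h R).1, fun R => (h R).2.1, fun R => (h R).2.2.1, fun R => (h R).2.2.2,
      daRule_strategyProof hC hD⟩
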